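/- Let $\kappa$ be an uncountable cardinal. Then there exists a Hausdorff topological group $G$ with the following properties. (a) $G$ is Fréchet–Urysohn: whenever $A\subseteq G$ and $x\in\overline{A}$, some sequence of points of $A$ converges to $x$. (b) $G$ is minimal: if $\mathscr T$ is the topology of $G$ and $\mathscr T'\subseteq\mathscr T$ is a Hausdorff group topology on $G$, then $\mathscr T'=\mathscr T$. (c) $\chi(G)=\kappa$, where the character $\chi(X)$ of a space $X$ is the maximum of $\aleph_0$ and the supremum over $x\in X$ of the least cardinality of a neighbourhood base at $x$. (d) The connected component $c(G)$ of the identity of $G$ is an open normal subgroup of $G$ and, as a subspace, it is $\omega$-bounded: the closure in $c(G)$ of every countable subset of $c(G)$ is compact. (e) $G$ is locally precompact: it is topologically isomorphic to a subgroup of some locally compact Hausdorff group. -/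

import Mathlib

open Topology Cardinal

universe u

/-- The least cardinality of a neighbourhood base at the point `x`. -/
noncomputable def pointCharacter {X : Type u} [TopologicalSpace X] (x : X) : Cardinal.{u} :=
  sInf {c : Cardinal.{u} | ∃ B : Set (Set X),
    (∀ V ∈ B, V ∈ 𝓝 x) ∧ (∀ U ∈ 𝓝 x, ∃ V ∈ B, V ⊆ U) ∧ #B = c}

/-- The character of a space: the supremum of the characters of its points. As usual for
cardinal functions in topology, only infinite values are taken. -/
noncomputable def spaceCharacter (X : Type u) [TopologicalSpace X] : Cardinal.{u} :=
  max ℵ₀ (⨆ x : X, pointCharacter x)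

/-- A space is `ω`-bounded if the closure of every countable subset is compact. -/
def IsOmegaBounded (X : Type u) [TopologicalSpace X] : Prop :=
  ∀ S : Set X, S.Countable → IsCompact (closure S)

/-- A Hausdorff topological group is minimal if its topology is the only Hausdorff group topology
contained in it. In Mathlib `t ≤ t'` says that every `t'`-open set is `t`-open. -/
def IsMinimalGroup (G : Type u) [Group G] [t : TopologicalSpace G] : Prop :=
  @IsTopologicalGroup G t _ ∧ @T2Space G t ∧
    ∀ t' : TopologicalSpace G, @IsTopologicalGroup G t' _ → @T2Space G t' → t ≤ t' → t' = t

/-- A topological group is locally precompact if it is topologically isomorphic to a subgroup of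
some locally compact Hausdorff group. -/
def IsLocallyPrecompactGroup (G : Type u) [Group G] [TopologicalSpace G] : Prop :=
  ∃ (L : Type u) (_ : Group L) (_ : TopologicalSpace L),
    IsTopologicalGroup L ∧ T2Space L ∧ LocallyCompactSpace L ∧ ∃ φ : G →* L, IsEmbedding φ

/-! `G` is the Σ-product of κ copies of `K`, the unit quaternions modulo their centre: a compact
connected metrizable group of trivial centre. Countably many elements of `G` live on a countable
index set `J`, hence in a copy of `K^J`. This makes `G` connected and ω-bounded, so its identity
component is everything, and a closing-off argument (`exists_countable_closure`) makes it
Fréchet–Urysohn.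

Minimality comes from conjugation: `f` acts on the `i`-th factor as `f i` does, and a centreless
compact `K` recovers `f i` continuously from this action (`continuous_of_conj_eq`). The character is
κ because basic neighbourhoods restrict only finitely many coordinates. -/

/-! ### Σ-products of topological groups -/

section SigmaProduct

variable {ι : Type*} {K : Type*} [Group K]

/-- The Σ-product: the families in `ι → K` of countable support. -/
def sigmaProduct (ι K : Type*) [Group K] : Subgroup (ι → K) where
  carrier := {f | (Function.mulSupport f).Countable}
  one_mem' := by simp
  mul_mem' {f g} hf hg := (hf.union hg).mono (Function.mulSupport_mul f g)
  inv_mem' {f} hf := by simpa using hf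

namespace sigmaProduct

lemma countable_mulSupport (f : sigmaProduct ι K) : (Function.mulSupport f.1).Countable := f.2

/-- Extension of a family over a countable set of indices by `1`. -/
noncomputable def extend {J : Set ι} (hJ : J.Countable) (f : J → K) : sigmaProduct ι K := by
  classical
  exact ⟨fun i => if h : i ∈ J then f ⟨i, h⟩ else 1, hJ.mono fun i hi => by
    by_contra h
    exact hi (dif_neg h)⟩

lemma extend_apply_mem {J : Set ι} (hJ : J.Countable) (f : J → K) {i : ι} (hi : i ∈ J) :
    (extend hJ f).1 i = f ⟨i, hi⟩ := dif_pos hi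

lemma extend_apply_notMem {J : Set ι} (hJ : J.Countable) (f : J → K) {i : ι} (hi : i ∉ J) :
    (extend hJ f).1 i = 1 := dif_neg hi

lemma extend_restrict {J : Set ι} (hJ : J.Countable) (f : sigmaProduct ι K)
    (hf : Function.mulSupport f.1 ⊆ J) : extend hJ (fun j => f.1 j) = f := by
  ext i
  by_cases hi : i ∈ J
  · rw [extend_apply_mem hJ _ hi]
  · rw [extend_apply_notMem hJ _ hi]
    by_contra h
    exact hi (hf (Ne.symm h))

/-- The inclusion of a factor into the Σ-product. -/
def single [DecidableEq ι] (i : ι) : K →* sigmaProduct ι K where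
  toFun a := ⟨Pi.mulSingle i a, (Set.countable_singleton i).mono Pi.mulSupport_mulSingle_subset⟩
  map_one' := by ext; simp
  map_mul' a b := by ext; simp [Pi.mulSingle_mul]

@[simp] lemma coe_single [DecidableEq ι] (i : ι) (a : K) :
    (single i a : sigmaProduct ι K).1 = Pi.mulSingle i a := rfl

variable [TopologicalSpace K]

lemma continuous_apply (i : ι) : Continuous fun f : sigmaProduct ι K => f.1 i :=
  (_root_.continuous_apply i).comp continuous_subtype_val

lemma continuous_extend {J : Set ι} (hJ : J.Countable) :
    Continuous (extend hJ : (J → K) → sigmaProduct ι K) := by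
  refine continuous_induced_rng.2 (continuous_pi fun i => ?_)
  by_cases hi : i ∈ J
  · exact (_root_.continuous_apply (⟨i, hi⟩ : J)).congr fun f => (extend_apply_mem hJ f hi).symm
  · exact continuous_const.congr fun f => (extend_apply_notMem hJ f hi).symm

lemma continuous_single [DecidableEq ι] (i : ι) :
    Continuous (single i : K → sigmaProduct ι K) :=
  continuous_induced_rng.2 (continuous_mulSingle (A := fun _ : ι => K) i)

/-- Each `f` lies together with `1` in the image of a connected power of `K`, indexed by the support
of `f`. -/
instance connectedSpace [ConnectedSpace K] : ConnectedSpace (sigmaProduct ι K) where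
  toPreconnectedSpace := ⟨isPreconnected_of_forall 1 fun f _ =>
    ⟨Set.range (extend (countable_mulSupport f)), Set.subset_univ _, ⟨fun _ => 1, by
      ext i
      by_cases hi : i ∈ Function.mulSupport f.1
      · rw [extend_apply_mem _ _ hi]; rfl
      · rw [extend_apply_notMem _ _ hi]; rfl⟩,
      ⟨fun j => f.1 j, extend_restrict _ f subset_rfl⟩,
      isPreconnected_range (continuous_extend _)⟩⟩
  toNonempty := ⟨1⟩

lemma isCompact_closure_of_countable [T2Space K] [CompactSpace K] {S : Set (sigmaProduct ι K)}
    (hS : S.Countable) : IsCompact (closure S) := by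
  have hJ : (⋃ f ∈ S, Function.mulSupport f.1).Countable := hS.biUnion fun f _ => f.2
  refine (isCompact_range (continuous_extend (K := K) hJ)).closure_of_subset fun f hf =>
    ⟨fun j => f.1 j, extend_restrict hJ f ?_⟩
  exact Set.subset_biUnion_of_mem (u := fun f : sigmaProduct ι K => Function.mulSupport f.1) hf

lemma exists_seq_tendsto_on [FirstCountableTopology K] {J : Set ι} (hJ : J.Countable)
    {A : Set (sigmaProduct ι K)} {x : sigmaProduct ι K} (hx : x ∈ closure A) :
    ∃ s : ℕ → sigmaProduct ι K, (∀ n, s n ∈ A) ∧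
      ∀ j ∈ J, Filter.Tendsto (fun n => (s n).1 j) Filter.atTop (𝓝 (x.1 j)) := by
  have := hJ.to_subtype
  have hr : Continuous fun (f : sigmaProduct ι K) (j : J) => f.1 j :=
    continuous_pi fun j => continuous_apply _
  obtain ⟨t, ht, hlim⟩ := mem_closure_iff_seq_limit.1
    (image_closure_subset_closure_image hr ⟨x, hx, rfl⟩)
  choose s hsA hst using ht
  refine ⟨s, hsA, fun j hj => ?_⟩
  refine (tendsto_pi_nhds.1 hlim ⟨j, hj⟩).congr fun n => ?_
  rw [← hst n]

lemma tendsto_iff {α : Type*} {l : Filter α} {s : α → sigmaProduct ι K} {x : sigmaProduct ι K} :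
    Filter.Tendsto s l (𝓝 x) ↔ ∀ i, Filter.Tendsto (fun n => (s n).1 i) l (𝓝 (x.1 i)) := by
  rw [tendsto_subtype_rng, tendsto_pi_nhds]

/-- Every point of a closure in a Σ-product is in the closure of a countable subset, on which the
convergence is controlled by countably many coordinates. -/
lemma exists_countable_closure [FirstCountableTopology K] {A : Set (sigmaProduct ι K)}
    {x : sigmaProduct ι K} (hx : x ∈ closure A) :
    ∃ B ⊆ A, B.Countable ∧ x ∈ closure B := by
  choose s hsA hs using fun J : {J : Set ι // J.Countable} => exists_seq_tendsto_on J.2 hx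
  -- Closing off: each stage adjoins the supports of a sequence that converges to `x` on the
  -- previous stage.
  let next : {J : Set ι // J.Countable} → {J : Set ι // J.Countable} := fun J =>
    ⟨J.1 ∪ ⋃ k, Function.mulSupport (s J k).1, J.2.union (Set.countable_iUnion fun k => (s J k).2)⟩
  let J : ℕ → {J : Set ι // J.Countable} := fun n => next^[n] ⟨Function.mulSupport x.1, x.2⟩
  have hJ : ∀ n, J (n + 1) = next (J n) := fun n => Function.iterate_succ_apply' _ _ _
  have hmono : Monotone fun n => (J n).1 := monotone_nat_of_le_succ fun n => by
    rw [hJ]; exact Set.subset_union_left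
  have hsupp : ∀ n k, Function.mulSupport (s (J n) k).1 ⊆ (J (n + 1)).1 := fun n k => by
    rw [hJ]
    exact (Set.subset_iUnion (fun k => Function.mulSupport (s (J n) k).1) k).trans
      Set.subset_union_right
  refine ⟨⋃ n, Set.range (s (J n)), Set.iUnion_subset fun n => Set.range_subset_iff.2 (hsA _),
    Set.countable_iUnion fun n => Set.countable_range _, ?_⟩
  rw [mem_closure_iff_nhds]
  intro U hU
  -- the sequences of one stage need only converge on the finitely many relevant coordinates
  rw [nhds_subtype_eq_comap, nhds_pi, Filter.mem_comap] at hU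
  obtain ⟨V, hV, hVU⟩ := hU
  obtain ⟨F, hF, W, hW, hWV⟩ := Filter.mem_pi.1 hV
  have hstage : ∃ n, ∀ i ∈ F, (∃ m, i ∈ (J m).1) → i ∈ (J n).1 := by
    classical
    choose! m hm using fun (i : ι) (h : ∃ m, i ∈ (J m).1) => h
    refine ⟨hF.toFinset.sup m, fun i hi h => ?_⟩
    exact hmono (Finset.le_sup (f := m) (hF.mem_toFinset.2 hi)) (hm i h)
  obtain ⟨n, hn⟩ := hstage
  have hev : ∀ᶠ k in Filter.atTop, ∀ i ∈ F, (s (J n) k).1 i ∈ W i := by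
    rw [Filter.eventually_all_finite hF]
    intro i hi
    by_cases h : ∃ m, i ∈ (J m).1
    · exact hs (J n) i (hn i hi h) (hW i)
    -- A coordinate outside every stage is trivial both for `x` and for the whole sequence.
    · push Not at h
      refine Filter.Eventually.of_forall fun k => ?_
      have h1 : (s (J n) k).1 i = 1 := by
        by_contra hne
        exact h (n + 1) (hsupp n k hne)
      have h2 : x.1 i = 1 := by
        by_contra hne
        exact h 0 hne
      rw [h1, ← h2]
      exact mem_of_mem_nhds (hW i)
  obtain ⟨k, hk⟩ := hev.exists
  exact ⟨s (J n) k, hVU (hWV fun i hi => hk i hi), Set.mem_iUnion.2 ⟨n, k, rfl⟩⟩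

/-- Once `A` is replaced by a countable `B`, all coordinates outside a countable set are `1`, so
convergence on that set suffices. -/
instance frechetUrysohnSpace [FirstCountableTopology K] :
    FrechetUrysohnSpace (sigmaProduct ι K) where
  closure_subset_seqClosure A x hx := by
    obtain ⟨B, hBA, hB, hxB⟩ := exists_countable_closure hx
    have hJ : (Function.mulSupport x.1 ∪ ⋃ f ∈ B, Function.mulSupport f.1).Countable :=
      x.2.union (hB.biUnion fun f _ => f.2)
    obtain ⟨s, hsB, hs⟩ := exists_seq_tendsto_on hJ hxB
    refine ⟨s, fun n => hBA (hsB n), tendsto_iff.2 fun i => ?_⟩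
    by_cases hi : i ∈ Function.mulSupport x.1 ∪ ⋃ f ∈ B, Function.mulSupport f.1
    · exact hs i hi
    · have h1 : ∀ n, (s n).1 i = 1 := fun n => by
        by_contra hne
        exact hi (Or.inr (Set.mem_biUnion (hsB n) hne))
      have h2 : x.1 i = 1 := by
        by_contra hne
        exact hi (Or.inl hne)
      simpa only [h1, h2] using tendsto_const_nhds

end sigmaProduct

end SigmaProduct

lemma isOmegaBounded_of_isClosed {X : Type*} [TopologicalSpace X] (hX : IsOmegaBounded X)
    {C : Set X} (hC : IsClosed C) : IsOmegaBounded C := fun S hS => by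
  rw [hC.isClosedEmbedding_subtypeVal.isInducing.closure_eq_preimage_closure_image]
  exact hC.isClosedEmbedding_subtypeVal.isCompact_preimage (hX _ (hS.image _))

/-! ### Minimality -/

section Minimal

variable {K : Type*} [Group K] [TopologicalSpace K] [IsTopologicalGroup K] [CompactSpace K]

/-- Let a compact group `K` of trivial centre map injectively and continuously to a Hausdorff
group `H`. A map `p : H → K` such that every `h` acts on `K` by conjugation as `p h` does is
continuous. -/
lemma continuous_of_conj_eq (hK : Subgroup.center K = ⊥) {H : Type*} [Group H]
    [TopologicalSpace H] [IsTopologicalGroup H] [T2Space H] (s : K →* H) (hs : Continuous s)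
    (hinj : Function.Injective s) (p : H → K)
    (hp : ∀ h a, s (p h * a * (p h)⁻¹) = h * s a * h⁻¹) : Continuous p := by
  -- Sending `x` to its conjugation action is injective as the centre is trivial, hence a closed
  -- embedding of the compact `K` into `K → H`. After it, `p` becomes `h ↦ h * s a * h⁻¹`, visibly
  -- continuous.
  have he : IsClosedEmbedding fun (x : K) (a : K) => s (x * a * x⁻¹) := by
    refine Continuous.isClosedEmbedding (by fun_prop) fun x y hxy => ?_
    have hc : y⁻¹ * x ∈ Subgroup.center K := by
      refine Subgroup.mem_center_iff.2 fun a => ?_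
      have h : x * a * x⁻¹ = y * a * y⁻¹ := hinj (congrFun hxy a)
      have h' : x * a = y * a * y⁻¹ * x := by rw [← h]; group
      calc a * (y⁻¹ * x) = y⁻¹ * (y * a * y⁻¹ * x) := by group
        _ = y⁻¹ * x * a := by rw [← h', mul_assoc]
    rw [hK, Subgroup.mem_bot] at hc
    exact (inv_mul_eq_one.1 hc).symm
  rw [he.isInducing.continuous_iff]
  refine continuous_pi fun a => ?_
  simp only [Function.comp_apply, hp]
  fun_prop

lemma sigmaProduct.isMinimalGroup {ι K : Type*} [Group K] [TopologicalSpace K]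
    [IsTopologicalGroup K] [CompactSpace K] [T2Space K] (hK : Subgroup.center K = ⊥) :
    IsMinimalGroup (sigmaProduct ι K) := by
  classical
  refine ⟨inferInstance, inferInstance, fun t' h1 h2 hle => le_antisymm ?_ hle⟩
  refine continuous_id_iff_le.1 (continuous_induced_rng.2 (continuous_pi fun i => ?_))
  refine @continuous_of_conj_eq K _ _ _ _ hK (sigmaProduct ι K) _ t' h1 h2 (single i)
    (continuous_le_rng hle (continuous_single i)) ?_ (fun f => f.1 i) ?_
  · exact fun a b h => Pi.mulSingle_injective i (congrArg Subtype.val h)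
  · intro f a
    ext j
    rcases eq_or_ne j i with rfl | hj
    · simp
    · simp [Pi.mulSingle_eq_of_ne hj]

end Minimal

/-! ### The character -/

section Character

lemma pointCharacter_le {X : Type u} [TopologicalSpace X] {x : X} {β : Type u} {p : β → Prop}
    {s : β → Set X} (h : (𝓝 x).HasBasis p s) : pointCharacter x ≤ #β := by
  have hle : pointCharacter x ≤ #(s '' {b | p b}) := csInf_le' ⟨s '' {b | p b}, ?_, ?_, rfl⟩
  · exact hle.trans (mk_image_le.trans (mk_set_le _))
  · rintro _ ⟨b, hb, rfl⟩
    exact h.mem_of_mem hb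
  · intro U hU
    obtain ⟨b, hb, hbU⟩ := h.mem_iff.1 hU
    exact ⟨_, ⟨b, hb, rfl⟩, hbU⟩

lemma le_pointCharacter {X : Type u} [TopologicalSpace X] {x : X} {c : Cardinal.{u}}
    (h : ∀ B : Set (Set X), (∀ V ∈ B, V ∈ 𝓝 x) → (∀ U ∈ 𝓝 x, ∃ V ∈ B, V ⊆ U) → c ≤ #B) :
    c ≤ pointCharacter x := by
  refine le_csInf ⟨_, {V | V ∈ 𝓝 x}, fun _ hV => hV, fun U hU => ⟨U, hU, subset_rfl⟩, rfl⟩ ?_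
  rintro _ ⟨B, hB, hB', rfl⟩
  exact h B hB hB'

variable {ι : Type u} {K : Type} [Group K] [TopologicalSpace K]

lemma sigmaProduct.pointCharacter_le [FirstCountableTopology K] (hι : ℵ₀ ≤ #ι)
    (x : sigmaProduct ι K) : pointCharacter x ≤ #ι := by
  have := infinite_iff.2 hι
  choose u hu using fun i => (𝓝 (x.1 i)).exists_antitone_basis
  have hb : (𝓝 x).HasBasis (fun _ : Finset ι × ℕ => True)
      fun q => {f : sigmaProduct ι K | ∀ i ∈ q.1, f.1 i ∈ u i q.2} := by
    refine ⟨fun U => ?_⟩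
    rw [nhds_subtype_eq_comap, nhds_pi]
    constructor
    · rintro ⟨V, hV, hVU⟩
      obtain ⟨F, hF, W, hW, hWV⟩ := Filter.mem_pi.1 hV
      choose n hn using fun i => (hu i).mem_iff.1 (hW i)
      refine ⟨(hF.toFinset, hF.toFinset.sup n), trivial, fun f hf => hVU (hWV fun i hi => ?_)⟩
      have hi' := hF.mem_toFinset.2 hi
      exact hn i ((hu i).antitone (Finset.le_sup (f := n) hi') (hf i hi'))
    · rintro ⟨⟨F, n⟩, -, hU⟩
      refine Filter.mem_of_superset (Filter.preimage_mem_comap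
        (Filter.pi_mem_pi F.finite_toSet fun i _ => (hu i).mem n)) fun f hf => hU fun i hi => ?_
      exact hf i hi
  have hc : #(Finset ι × ULift.{u} ℕ) = #ι := by
    rw [← mul_def, mk_finset_of_infinite, mk_uLift, mk_nat, lift_aleph0, mul_aleph0_eq hι]
  rw [← hc]
  refine _root_.pointCharacter_le (p := fun _ => True)
    (s := fun q => {f : sigmaProduct ι K | ∀ i ∈ q.1, f.1 i ∈ u i q.2.down}) ⟨fun U => ?_⟩
  rw [hb.mem_iff]
  exact ⟨fun ⟨q, h, hq⟩ => ⟨(q.1, ⟨q.2⟩), h, hq⟩, fun ⟨q, h, hq⟩ => ⟨(q.1, q.2.down), h, hq⟩⟩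

/-- Fewer than `#ι` neighbourhoods of `1` restrict fewer than `#ι` coordinates in all; an element
supported on a free coordinate lies in every one of them. -/
lemma sigmaProduct.le_pointCharacter_one [T1Space K] [Nontrivial K] (hι : ℵ₀ < #ι) :
    #ι ≤ pointCharacter (1 : sigmaProduct ι K) := by
  classical
  refine le_pointCharacter fun B hB hB' => ?_
  by_contra! hlt
  have hF : ∀ V : B, ∃ F : Finset ι, ∀ f : sigmaProduct ι K, (∀ i ∈ F, f.1 i = 1) → f ∈ V.1 := by
    intro V
    have hV := hB _ V.2
    rw [nhds_subtype_eq_comap, nhds_pi] at hV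
    obtain ⟨V', hV', hVV⟩ := hV
    obtain ⟨F, hF, W, hW, hWV⟩ := Filter.mem_pi.1 hV'
    refine ⟨hF.toFinset, fun f hf => hVV (hWV fun i hi => ?_)⟩
    rw [hf i (hF.mem_toFinset.2 hi)]
    exact mem_of_mem_nhds (hW i)
  choose F hF using hF
  have hcard : #(⋃ V, (F V : Set ι)) < #ι := by
    refine (mk_iUnion_le _).trans_lt ?_
    refine (mul_le_mul' le_rfl (ciSup_le' fun V => (?_ : _ ≤ ℵ₀))).trans_lt
      (mul_lt_of_lt hι.le hlt hι)
    exact (mk_lt_aleph0 : #(F V : Set ι) < ℵ₀).le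
  obtain ⟨i, hi⟩ : ∃ i, i ∉ ⋃ V, (F V : Set ι) := by
    by_contra! h
    rw [Set.eq_univ_of_forall h, mk_univ] at hcard
    exact hcard.false
  obtain ⟨a, ha⟩ := exists_ne (1 : K)
  have hU : {f : sigmaProduct ι K | f.1 i ≠ a} ∈ 𝓝 (1 : sigmaProduct ι K) :=
    (isOpen_compl_singleton.preimage (continuous_apply i)).mem_nhds (Ne.symm ha)
  obtain ⟨V, hVB, hVU⟩ := hB' _ hU
  refine hVU (hF ⟨V, hVB⟩ (single i a) fun j hj => ?_) (by simp)
  have hji : j ≠ i := by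
    rintro rfl
    exact hi (Set.mem_iUnion.2 ⟨_, hj⟩)
  simp [Pi.mulSingle_eq_of_ne hji]

lemma sigmaProduct.spaceCharacter_eq [FirstCountableTopology K] [T1Space K] [Nontrivial K]
    (hι : ℵ₀ < #ι) : spaceCharacter (sigmaProduct ι K) = #ι := by
  have hle := sigmaProduct.pointCharacter_le (K := K) hι.le
  refine le_antisymm (max_le hι.le (ciSup_le' hle)) (le_max_of_le_right ?_)
  exact (sigmaProduct.le_pointCharacter_one hι).trans
    (le_ciSup (f := fun x : sigmaProduct ι K => pointCharacter x)
      ⟨_, Set.forall_mem_range.2 hle⟩ 1)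

end Character

/-! ### A connected compact metrizable group of trivial centre -/

section Centerless

/-- A connected group modulo a finite centre has trivial centre. -/
lemma center_quotient_center {S : Type*} [Group S] [TopologicalSpace S] [IsTopologicalGroup S]
    [T1Space S] [PreconnectedSpace S] (hfin : (Subgroup.center S : Set S).Finite) :
    Subgroup.center (S ⧸ Subgroup.center S) = ⊥ := by
  rw [eq_bot_iff]
  intro q hq
  obtain ⟨x, rfl⟩ := QuotientGroup.mk_surjective q
  rw [Subgroup.mem_bot, QuotientGroup.eq_one_iff]
  have hmem : ∀ y : S, y * x * y⁻¹ * x⁻¹ ∈ Subgroup.center S := fun y => by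
    rw [← QuotientGroup.eq_one_iff]
    have := Subgroup.mem_center_iff.1 hq (y : S ⧸ Subgroup.center S)
    simp only [QuotientGroup.mk_mul, QuotientGroup.mk_inv, this]
    group
  -- The commutators with `x` form a connected subset of the finite centre, hence a single point.
  have hsub : (Set.range fun y : S => y * x * y⁻¹ * x⁻¹).Subsingleton := by
    by_contra hne
    exact (isPreconnected_range (by fun_prop)).infinite_of_nontrivial
      (Set.not_subsingleton_iff.1 hne) (hfin.subset (Set.range_subset_iff.2 hmem))
  refine Subgroup.mem_center_iff.2 fun y => ?_
  have h : y * x * y⁻¹ * x⁻¹ = 1 * x * 1⁻¹ * x⁻¹ := hsub ⟨y, rfl⟩ ⟨1, rfl⟩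
  have h' : y * x * y⁻¹ * x⁻¹ = 1 := by rw [h]; group
  rwa [mul_inv_eq_one, mul_inv_eq_iff_eq_mul] at h'

open Quaternion

/-- The group of unit quaternions. -/
abbrev UnitQuaternion : Type := Metric.sphere (0 : ℍ[ℝ]) 1

namespace UnitQuaternion

lemma mem_sphere_of_sq_add_sq {q : ℍ[ℝ]}
    (h : q.re ^ 2 + q.imI ^ 2 + q.imJ ^ 2 + q.imK ^ 2 = 1) : q ∈ Metric.sphere (0 : ℍ[ℝ]) 1 := by
  rw [mem_sphere_zero_iff_norm, ← mul_self_inj (norm_nonneg _) zero_le_one, one_mul,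
    ← Quaternion.normSq_eq_norm_mul_self, Quaternion.normSq_def']
  exact h

/-- The quaternion `i`. -/
def i : UnitQuaternion := ⟨(⟨0, 1, 0, 0⟩ : ℍ[ℝ]), mem_sphere_of_sq_add_sq (by norm_num)⟩

/-- The quaternion `j`. -/
def j : UnitQuaternion := ⟨(⟨0, 0, 1, 0⟩ : ℍ[ℝ]), mem_sphere_of_sq_add_sq (by norm_num)⟩

@[simp] lemma re_i : i.1.re = 0 := rfl
@[simp] lemma imI_i : i.1.imI = 1 := rfl
@[simp] lemma imJ_i : i.1.imJ = 0 := rfl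
@[simp] lemma imK_i : i.1.imK = 0 := rfl
@[simp] lemma re_j : j.1.re = 0 := rfl
@[simp] lemma imI_j : j.1.imI = 0 := rfl
@[simp] lemma imJ_j : j.1.imJ = 1 := rfl
@[simp] lemma imK_j : j.1.imK = 0 := rfl

lemma i_mul_j_ne : i * j ≠ j * i := fun h => by
  have := congrArg (fun q : UnitQuaternion => q.1.imK) h
  norm_num at this

/-- Commuting with `i` kills the `j` and `k` parts, commuting with `j` kills the `i` part, and norm
one leaves `±1`. -/
lemma finite_center : (Subgroup.center UnitQuaternion : Set UnitQuaternion).Finite := by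
  refine (Set.toFinite ({1, -1} : Set UnitQuaternion)).subset fun q hq => ?_
  have hi := congrArg Subtype.val (Subgroup.mem_center_iff.1 hq i)
  have hj := congrArg Subtype.val (Subgroup.mem_center_iff.1 hq j)
  have hiJ := congrArg QuaternionAlgebra.imJ hi
  have hiK := congrArg QuaternionAlgebra.imK hi
  have hjK := congrArg QuaternionAlgebra.imK hj
  simp at hiJ hiK hjK
  have h2 : q.1.imJ = 0 := by linarith
  have h3 : q.1.imK = 0 := by linarith
  have h1 : q.1.imI = 0 := by linarith
  have hq : q.1 = (q.1.re : ℍ[ℝ]) := by ext <;> simp [h1, h2, h3]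
  have hn : ‖q.1‖ = 1 := mem_sphere_zero_iff_norm.1 q.2
  rw [hq, Quaternion.norm_coe, Real.norm_eq_abs] at hn
  rcases eq_or_eq_neg_of_abs_eq hn with h | h <;> rw [h] at hq
  · exact Or.inl (Subtype.ext (by simpa using hq))
  · exact Or.inr (Subtype.ext (by simpa using hq))

instance connectedSpace : ConnectedSpace UnitQuaternion :=
  isConnected_iff_connectedSpace.1 (isConnected_sphere (by
    rw [← Module.finrank_eq_rank, Quaternion.finrank_eq_four]; norm_num) 0 zero_le_one)

end UnitQuaternion

/-- The group of rotations of space, as unit quaternions modulo their centre. -/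
abbrev ProjectiveUnitQuaternion : Type := UnitQuaternion ⧸ Subgroup.center UnitQuaternion

namespace ProjectiveUnitQuaternion

instance isClosed_center : IsClosed (Subgroup.center UnitQuaternion : Set UnitQuaternion) :=
  UnitQuaternion.finite_center.isClosed

instance nontrivial : Nontrivial ProjectiveUnitQuaternion := by
  refine ⟨(UnitQuaternion.i : ProjectiveUnitQuaternion), 1, fun h => ?_⟩
  rw [QuotientGroup.eq_one_iff] at h
  exact UnitQuaternion.i_mul_j_ne (Subgroup.mem_center_iff.1 h UnitQuaternion.j).symm

instance connectedSpace : ConnectedSpace ProjectiveUnitQuaternion :=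
  QuotientGroup.mk_surjective.connectedSpace continuous_quotient_mk'

end ProjectiveUnitQuaternion

end Centerless

theorem corollary6p7 (κ : Cardinal.{u}) (hκ : ℵ₀ < κ) :
    ∃ (G : Type u) (_ : Group G) (_ : TopologicalSpace G) (_ : IsTopologicalGroup G)
      (_ : T2Space G),
      FrechetUrysohnSpace G ∧ IsMinimalGroup G ∧ spaceCharacter G = κ ∧
      IsOpen (Subgroup.connectedComponentOfOne G : Set G) ∧
      (Subgroup.connectedComponentOfOne G).Normal ∧
      IsOmegaBounded (Subgroup.connectedComponentOfOne G) ∧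
      IsLocallyPrecompactGroup G := by
  obtain ⟨ι, rfl⟩ : ∃ ι : Type u, #ι = κ := ⟨κ.out, mk_out κ⟩
  have hc : (Subgroup.connectedComponentOfOne (sigmaProduct ι ProjectiveUnitQuaternion) :
      Set (sigmaProduct ι ProjectiveUnitQuaternion)) = Set.univ :=
    PreconnectedSpace.connectedComponent_eq_univ 1
  refine ⟨sigmaProduct ι ProjectiveUnitQuaternion, inferInstance, inferInstance, inferInstance,
    inferInstance, inferInstance, sigmaProduct.isMinimalGroup ?_,
    sigmaProduct.spaceCharacter_eq hκ, hc ▸ isOpen_univ, ?_, ?_, ?_⟩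
  · exact center_quotient_center UnitQuaternion.finite_center
  · rw [SetLike.coe_set_eq.1 (hc.trans Subgroup.coe_top.symm)]
    infer_instance
  · exact isOmegaBounded_of_isClosed (fun _ => sigmaProduct.isCompact_closure_of_countable)
      isClosed_connectedComponent
  -- The ambient full power is compact.
  · exact ⟨ι → ProjectiveUnitQuaternion, inferInstance, inferInstance, inferInstance,
      inferInstance, inferInstance, Subgroup.subtype _, IsEmbedding.subtypeVal⟩
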